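/- Let $q\ge 1$ be a fixed integer and let $K_n,P_n$ be integers with $q\le K_n\le P_n$ for all large $n$. Each of $n$ sensors independently receives a key ring, a uniformly random $K_n$-element subset of a pool of $P_n$ keys. In the $q$-composite network under full visibility, two distinct sensors have a secure link iff their key rings share at least $q$ keys. If an adversary captures a set $S$ of sensors, the compromised keys are all keys in the key rings of the sensors of $S$. Suppose that for some constant $c>1$ we have $\frac{1}{q!}\cdot\frac{K_n^{2q}}{P_n^{q}}\ge \frac{c\ln n}{n}$ for all sufficiently large $n$, and that $K_n=\omega(\ln n)$ and $K_n=o\big(\min\{\sqrt{P_n},\,P_n/n\}\big)$ as $n\to\infty$. Then: 1. The network is unsplittable: for every sequence of non-negative integers $m_n=o(n)$ and every $\varepsilon>0$, with probability tending to $1$ as $n\to\infty$, there is no set $S$ of at most $m_n$ sensors (possibly chosen with knowledge of all key rings) for which the sensors outside $S$ can be partitioned into two sets $A,B$, each of size at least $\varepsilon n$, such that for every secure link between $A$ and $B$ all keys shared by its two end points are compromised (in particular, $A$ and $B$ isolated from each other is excluded). 2. For every sequence of non-negative integers $m_n=o(n)$ there is a sequence $\ell_n=o(n)$ such that, with probability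 tending to $1$ as $n\to\infty$, for every set $S$ of at most $m_n$ captured sensors there are at least $n-\ell_n$ non-captured sensors that form a connected graph when two distinct sensors are joined iff they share at least $q$ non-compromised keys. -/

import Mathlib

open Filter Topology MeasureTheory ProbabilityTheory Asymptotics

/-- A key ring: a set of exactly `K` distinct keys from the key pool `Fin P`. -/
def KeyRing (P K : ℕ) : Type := {s : Finset (Fin P) // s.card = K}

namespace KeyRing

/-- The set of keys of a key ring. -/
def keys {P K : ℕ} (r : KeyRing P K) : Finset (Fin P) := r.1

/-- Every set of key rings is an event. -/
instance instMeasurableSpace (P K : ℕ) : MeasurableSpace (KeyRing P K) := ⊤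

end KeyRing

/-- The outcome of key predistribution: a key ring for each of the `n` sensors. -/
abbrev KeyAssignment (n P K : ℕ) : Type := Fin n → KeyRing P K

/-- The law of the key assignment: the key rings of the `n` sensors are independent, and each is
uniformly distributed among all `K`-element subsets of the key pool. -/
noncomputable def keyLaw (n P K : ℕ) : Measure (KeyAssignment n P K) :=
  Measure.pi fun _ => uniformOn (Set.univ : Set (KeyRing P K))

/-- A sequence of events on the key assignments (one for each number `n` of sensors) holds with
high probability if its probability tends to `1` as `n → ∞`. -/
def WithHighProbability (K P : ℕ → ℕ) (E : ∀ n, KeyAssignment n (P n) (K n) → Prop) : Prop :=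
  Tendsto (fun n => keyLaw n (P n) (K n) {R | E n R}) atTop (𝓝 1)

section Network

variable {n P K : ℕ}

/-- The keys shared by sensors `i` and `j`. -/
def sharedKeys (R : KeyAssignment n P K) (i j : Fin n) : Finset (Fin P) :=
  (R i).keys ∩ (R j).keys

/-- The secure sensor network with the `q`-composite scheme under full visibility: two distinct
sensors have a secure link iff they share at least `q` keys. -/
def network (q : ℕ) (R : KeyAssignment n P K) : SimpleGraph (Fin n) where
  Adj i j := i ≠ j ∧ q ≤ (sharedKeys R i j).card
  symm := ⟨fun i j h => ⟨h.1.symm, by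
    have e : sharedKeys R j i = sharedKeys R i j := Finset.inter_comm _ _
    rw [e]; exact h.2⟩⟩
  loopless := ⟨fun _ h => h.1 rfl⟩

/-- The keys compromised by the capture of the set `S` of sensors: all keys in their rings. -/
def compromisedKeys (R : KeyAssignment n P K) (S : Finset (Fin n)) : Finset (Fin P) :=
  S.biUnion fun i => (R i).keys

/-- The network formed by the `q`-composite scheme when only keys that are not compromised by the
capture of `S` are used: two distinct sensors are linked iff they share at least `q`
non-compromised keys. -/
def uncompromisedNetwork (q : ℕ) (R : KeyAssignment n P K) (S : Finset (Fin n)) :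
    SimpleGraph (Fin n) where
  Adj i j := i ≠ j ∧ q ≤ (sharedKeys R i j \ compromisedKeys R S).card
  symm := ⟨fun i j h => ⟨h.1.symm, by
    have e : sharedKeys R j i = sharedKeys R i j := Finset.inter_comm _ _
    rw [e]; exact h.2⟩⟩
  loopless := ⟨fun _ h => h.1 rfl⟩

/-- The capture of `S` splits the network into the chunks `A` and `B`: these partition the
non-captured sensors, and they are isolated from each other or all keys used by the secure links
between them are compromised (isolation is the case where there are no such links). -/
def SplitsInto (q : ℕ) (R : KeyAssignment n P K) (S A B : Finset (Fin n)) : Prop :=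
  Disjoint A B ∧ A ∪ B = Sᶜ ∧
    ∀ a ∈ A, ∀ b ∈ B, (network q R).Adj a b → sharedKeys R a b ⊆ compromisedKeys R S

end Network

/-- Unsplittability: for every bound `m n = o(n)` on the number of captured sensors and every
`ε > 0`, with high probability no capture of a set of at most `m n` sensors (the set may depend on
the key assignment) splits the network into two chunks of at least `ε n` sensors each. -/
def Unsplittable (q : ℕ) (K P : ℕ → ℕ) : Prop :=
  ∀ m : ℕ → ℕ, (fun n => (m n : ℝ)) =o[atTop] (fun n : ℕ => (n : ℝ)) →
    ∀ ε : ℝ, 0 < ε →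
      WithHighProbability K P fun n R =>
        ¬ ∃ S A B : Finset (Fin n), S.card ≤ m n ∧ SplitsInto q R S A B ∧
          ε * n ≤ A.card ∧ ε * n ≤ B.card

/-- For every bound `m n = o(n)` on the number of captured sensors there is `ℓ n = o(n)` such that
with high probability, for every set `S` of at most `m n` captured sensors, at least `n - ℓ n`
non-captured sensors form a connected graph by means of non-compromised keys only. -/
def RemainsSecurelyConnected (q : ℕ) (K P : ℕ → ℕ) : Prop :=
  ∀ m : ℕ → ℕ, (fun n => (m n : ℝ)) =o[atTop] (fun n : ℕ => (n : ℝ)) →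
    ∃ ℓ : ℕ → ℝ, ℓ =o[atTop] (fun n : ℕ => (n : ℝ)) ∧
      WithHighProbability K P fun n R =>
        ∀ S : Finset (Fin n), S.card ≤ m n →
          ∃ T : Finset (Fin n), Disjoint T S ∧ (n : ℝ) - ℓ n ≤ T.card ∧
            ((uncompromisedNetwork q R S).induce (T : Set (Fin n))).Connected

/-! Everything reduces to the single event `LargeChunksLinked`: any two disjoint sets A, B of at
least εn sensors contain a pair sharing q keys that no sensor outside A ∪ B holds. Captured sensors
lie outside A ∪ B, so such a link survives every capture, whatever its size and however S is chosen;
no union bound over S is needed. This forbids splitting, and by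
`exists_connected_of_forall_exists_adj` it leaves a connected set missing at most εn uncaptured
sensors.

For fixed A and B, expose the rings outside B. Since nK/P → 0, at least half of each ring is
private, and private parts of different sensors are disjoint. The expected number of q-sets, each
inside the private part of one sensor of A, that a fresh ring contains is of order |A| (K²/P)^q /
q!, hence at least of order ε log n. The second moment bound `card_filter_forall_inter_lt_mul_le`
makes a miss by one ring of B less likely than any fixed constant η. The rings of B are independent
(`measure_pi_le_pow_card`), so all of them miss with probability at most η^(εn); with η = exp(-3/ε)
this beats the 4^n pairs (A, B). -/

/-- The probability that a uniformly random `K`-subset of a `P`-set contains a given `t`-subset. -/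
noncomputable def inclusionProb (P K t : ℕ) : ℝ :=
  ∏ i ∈ Finset.range t, ((K : ℝ) - i) / ((P : ℝ) - i)

/-! ### Inclusion probabilities of a random K-subset. -/

section InclusionProb

variable {P K : ℕ}

lemma choose_sub_eq_inclusionProb_mul (hKP : K ≤ P) {t : ℕ} (ht : t ≤ K) :
    ((P - t).choose (K - t) : ℝ) = inclusionProb P K t * P.choose K := by
  induction t with
  | zero => simp [inclusionProb]
  | succ t ih =>
    obtain ⟨k, rfl⟩ := Nat.exists_eq_add_of_le ht
    obtain ⟨p, rfl⟩ := Nat.exists_eq_add_of_le (ht.trans hKP)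
    have h := ih (by omega)
    have e1 : t + 1 + p - t = p + 1 := by omega
    have e2 : t + 1 + k - t = k + 1 := by omega
    have e3 : t + 1 + p - (t + 1) = p := by omega
    have e4 : t + 1 + k - (t + 1) = k := by omega
    rw [e1, e2] at h
    rw [e3, e4, inclusionProb, Finset.prod_range_succ, mul_right_comm, ← inclusionProb, ← h]
    have hc : ((p : ℝ) + 1) * p.choose k = (p + 1).choose (k + 1) * (k + 1) := by
      exact_mod_cast Nat.add_one_mul_choose_eq p k
    push_cast
    have e5 : (t : ℝ) + 1 + k - t = k + 1 := by ring
    have e6 : (t : ℝ) + 1 + p - t = p + 1 := by ring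
    have hp : (p : ℝ) + 1 ≠ 0 := by positivity
    rw [e5, e6, ← mul_div_assoc, eq_div_iff hp, ← hc]
    ring

lemma inclusionProb_nonneg (hKP : K ≤ P) {t : ℕ} (ht : t ≤ K) : 0 ≤ inclusionProb P K t := by
  refine Finset.prod_nonneg fun i hi => ?_
  have h1 : (i : ℝ) ≤ K := by
    exact_mod_cast ((Finset.mem_range.1 hi).le.trans ht)
  have h2 : (K : ℝ) ≤ P := by exact_mod_cast hKP
  exact div_nonneg (by linarith) (by linarith)

lemma sub_div_sub_le {x y i j : ℝ} (hxy : x ≤ y) (hij : i ≤ j) (hjy : j < y) :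
    (x - j) / (y - j) ≤ (x - i) / (y - i) := by
  rw [div_le_div_iff₀ (by linarith) (by linarith)]
  nlinarith [mul_nonneg (sub_nonneg.2 hxy) (sub_nonneg.2 hij)]

/-- Negative correlation of sampling without replacement: the factors (K - i)/(P - i) decrease in i
because K ≤ P. -/
lemma inclusionProb_add_le_mul (hKP : K ≤ P) {s t : ℕ} (h : s + t ≤ K) :
    inclusionProb P K (s + t) ≤ inclusionProb P K s * inclusionProb P K t := by
  have h2 : (K : ℝ) ≤ P := by exact_mod_cast hKP
  rw [inclusionProb, Finset.prod_range_add, ← inclusionProb]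
  refine mul_le_mul_of_nonneg_left ?_ (inclusionProb_nonneg hKP (by omega))
  refine Finset.prod_le_prod (fun i hi => ?_) fun i hi => ?_
  all_goals
    have h1 : ((s + i : ℕ) : ℝ) < K := by
      have := Finset.mem_range.1 hi
      exact_mod_cast (by omega : s + i < K)
  · exact div_nonneg (by linarith) (by linarith)
  · exact sub_div_sub_le h2 (by push_cast; simp) (by linarith)

lemma inclusionProb_le_pow (hKP : K ≤ P) {t : ℕ} (h : t ≤ K) :
    inclusionProb P K t ≤ ((K : ℝ) / P) ^ t := by
  have h2 : (K : ℝ) ≤ P := by exact_mod_cast hKP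
  conv_rhs => rw [← Finset.card_range t, ← Finset.prod_const]
  refine Finset.prod_le_prod (fun i hi => ?_) fun i hi => ?_
  all_goals
    have h1 : (i : ℝ) < K := by
      have := Finset.mem_range.1 hi
      exact_mod_cast (by omega : i < K)
  · exact div_nonneg (by linarith) (by linarith)
  · simpa using sub_div_sub_le h2 (Nat.cast_nonneg i) (by linarith)

lemma pow_le_inclusionProb (hKP : K ≤ P) {t : ℕ} (h : t ≤ K) :
    (((K : ℝ) - t) / P) ^ t ≤ inclusionProb P K t := by
  have h2 : (K : ℝ) ≤ P := by exact_mod_cast hKP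
  have h3 : (t : ℝ) ≤ K := by exact_mod_cast h
  have h4 : (((K : ℝ) - t) / P) ^ t = ∏ _i ∈ Finset.range t, ((K : ℝ) - t) / P := by
    rw [Finset.prod_const, Finset.card_range]
  rw [h4]
  refine Finset.prod_le_prod (fun i hi => ?_) fun i hi => ?_
  · exact div_nonneg (by linarith) (by positivity)
  · have h1 : (i : ℝ) < t := by exact_mod_cast Finset.mem_range.1 hi
    exact div_le_div₀ (by linarith) (by linarith) (by linarith) (by simp)

lemma inclusionProb_add_le_mul_pow (hKP : K ≤ P) {s t : ℕ} (h : s + t ≤ K) :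
    inclusionProb P K (s + t) ≤ inclusionProb P K s * ((K : ℝ) / P) ^ t :=
  (inclusionProb_add_le_mul hKP h).trans <| mul_le_mul_of_nonneg_left
    (inclusionProb_le_pow hKP (by omega)) (inclusionProb_nonneg hKP (by omega))

lemma card_filter_superset_powersetCard (hKP : K ≤ P) (T : Finset (Fin P)) (hT : T.card ≤ K) :
    ((((Finset.univ : Finset (Fin P)).powersetCard K).filter (T ⊆ ·)).card : ℝ) =
      inclusionProb P K T.card * P.choose K := by
  rw [← choose_sub_eq_inclusionProb_mul hKP hT,
    Finset.card_filter_powersetCard_subset _ _ _ (Finset.subset_univ _) hT]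
  simp

/-- Chernoff-type tail bound for the intersection of a random `K`-subset with a fixed set. -/
lemma card_filter_le_inter_le (hKP : K ≤ P) (U : Finset (Fin P)) {t : ℕ} (ht : t ≤ K)
    {x : ℝ} (hx : 0 < x) :
    ((((Finset.univ : Finset (Fin P)).powersetCard K).filter fun r => t ≤ (r ∩ U).card).card : ℝ) ≤
      Real.exp (x * (U.card * (K / P))) / x ^ t * P.choose K := by
  -- Union bound over the t-subsets of `U` that the ring may contain.
  have hsub : (((Finset.univ : Finset (Fin P)).powersetCard K).filter fun r => t ≤ (r ∩ U).card) ⊆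
      (U.powersetCard t).biUnion fun T =>
        ((Finset.univ : Finset (Fin P)).powersetCard K).filter (T ⊆ ·) := by
    intro r hr
    rw [Finset.mem_filter] at hr
    obtain ⟨T, hT, hc⟩ := Finset.exists_subset_card_eq hr.2
    rw [Finset.mem_biUnion]
    exact ⟨T, Finset.mem_powersetCard.2 ⟨hT.trans Finset.inter_subset_right, hc⟩,
      Finset.mem_filter.2 ⟨hr.1, hT.trans Finset.inter_subset_left⟩⟩
  have h1 := (Finset.card_le_card hsub).trans Finset.card_biUnion_le
  have h2 : ((((Finset.univ : Finset (Fin P)).powersetCard K).filter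
      fun r => t ≤ (r ∩ U).card).card : ℝ) ≤
      ∑ T ∈ U.powersetCard t, inclusionProb P K t * P.choose K := by
    refine (Nat.cast_le.2 h1).trans ?_
    push_cast
    refine Finset.sum_le_sum fun T hT => ?_
    have hc := (Finset.mem_powersetCard.1 hT).2
    rw [card_filter_superset_powersetCard hKP T (by omega), hc]
  refine h2.trans ?_
  rw [Finset.sum_const, Finset.card_powersetCard, nsmul_eq_mul, ← mul_assoc]
  refine mul_le_mul_of_nonneg_right ?_ (by positivity)
  have h3 : (U.card.choose t : ℝ) ≤ (U.card : ℝ) ^ t / t.factorial := Nat.choose_le_pow_div _ _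
  have h4 := inclusionProb_le_pow hKP ht
  -- y^t / t! ≤ exp y with y = x|U|K/P; the free parameter x plays the role of the exponential tilt.
  have h5 := Real.pow_div_factorial_le_exp (x := x * (U.card * (K / P))) (by positivity) t
  rw [le_div_iff₀ (by positivity)]
  calc (U.card.choose t : ℝ) * inclusionProb P K t * x ^ t
      ≤ (U.card : ℝ) ^ t / t.factorial * ((K : ℝ) / P) ^ t * x ^ t := by
        gcongr
        exact inclusionProb_nonneg hKP ht
    _ = (x * (U.card * (K / P))) ^ t / t.factorial := by
        rw [mul_pow, mul_pow]; ring
    _ ≤ _ := h5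

end InclusionProb

/-! ### Second moment method for disjoint blocks. -/

section SecondMoment

/-- The weight is multiplicative over the elements of S, so the sum is a product over `D` with
factor 2 on `T` and 1 + x ≤ exp x elsewhere. -/
lemma sum_powerset_pow_card_sdiff_le {α : Type*} [DecidableEq α] (D T : Finset α)
    {x : ℝ} (hx : 0 ≤ x) :
    ∑ S ∈ D.powerset, x ^ (S \ T).card ≤ 2 ^ T.card * Real.exp (D.card * x) := by
  have h1 : ∀ S : Finset α, x ^ (S \ T).card = ∏ i ∈ S, if i ∈ T then 1 else x := by
    intro S
    rw [Finset.prod_ite, Finset.prod_const_one, one_mul, Finset.prod_const]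
    congr 2
    ext; simp
  simp_rw [h1]
  rw [← Finset.prod_one_add]
  have h2 : ∀ i ∈ D, (1 + if i ∈ T then 1 else x) ≤ (if i ∈ T then (2 : ℝ) else 1) * Real.exp x := by
    intro i _
    split_ifs
    · have := Real.one_le_exp hx; linarith
    · have := Real.add_one_le_exp x; linarith
  refine (Finset.prod_le_prod (fun i _ => by split_ifs <;> positivity) h2).trans ?_
  rw [Finset.prod_mul_distrib, Finset.prod_const, ← Real.exp_nat_mul]
  refine mul_le_mul_of_nonneg_right ?_ (Real.exp_pos _).le
  rw [Finset.prod_ite, Finset.prod_const_one, mul_one, Finset.prod_const]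
  refine pow_le_pow_right₀ (by norm_num) (Finset.card_le_card ?_)
  intro i hi
  exact (Finset.mem_filter.1 hi).2

variable {P K q : ℕ} {ι : Type*}

/-- Second-moment bound: a random `K`-subset is unlikely to meet every block of a disjoint family
in fewer than `q` points. -/
lemma card_filter_forall_inter_lt_mul_le (hq : 1 ≤ q) (hqK : 2 * q ≤ K) (hKP : K ≤ P)
    (hK2 : (K : ℝ) * (K / P) ≤ 1) (A : Finset ι) (D : ι → Finset (Fin P))
    (hdisj : (A : Set ι).PairwiseDisjoint D) (hD : ∀ a ∈ A, (D a).card ≤ K) :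
    ((((Finset.univ : Finset (Fin P)).powersetCard K).filter
        fun r => ∀ a ∈ A, (r ∩ D a).card < q).card : ℝ) *
        ((∑ a ∈ A, ((D a).card.choose q : ℝ)) * inclusionProb P K q) ≤
      2 ^ q * Real.exp 1 * P.choose K := by
  set Ω := (Finset.univ : Finset (Fin P)).powersetCard K with hΩ
  set F := A.biUnion fun a => (D a).powersetCard q with hF
  set p := inclusionProb P K q with hp
  have hp0 : 0 ≤ p := inclusionProb_nonneg hKP (by omega)
  have hx : (0 : ℝ) ≤ (K : ℝ) / P := by positivity
  have hFcard : (F.card : ℝ) = ∑ a ∈ A, ((D a).card.choose q : ℝ) := by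
    rw [hF, Finset.card_biUnion]
    · simp
    · intro a ha b hb hab
      rw [Function.onFun, Finset.disjoint_left]
      intro T hTa hTb
      rw [Finset.mem_powersetCard] at hTa hTb
      obtain ⟨k, hk⟩ := Finset.card_pos.1 (by omega : 0 < T.card)
      exact Finset.disjoint_left.1 (hdisj ha hb hab) (hTa.1 hk) (hTb.1 hk)
  have hFq : ∀ T ∈ F, T.card = q := by
    intro T hT
    obtain ⟨a, -, h⟩ := Finset.mem_biUnion.1 hT
    exact (Finset.mem_powersetCard.1 h).2
  rw [← hFcard]
  set N : ℝ := (F.card : ℝ) with hN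
  set M : ℝ := (P.choose K : ℝ) with hM
  have hM0 : 0 ≤ M := by positivity
  have hN0 : 0 ≤ N := by positivity
  have hΩcard : (Ω.card : ℝ) = M := by simp [hΩ, hM]
  -- `X r` counts the q-sets of `F` inside r. It has mean N p and vanishes on the bad rings, so
  -- Chebyshev's inequality applies.
  let X : Finset (Fin P) → ℝ := fun r => ∑ T ∈ F, if T ⊆ r then 1 else 0
  have hcount : ∀ T : Finset (Fin P), T.card ≤ K →
      (∑ r ∈ Ω, if T ⊆ r then (1 : ℝ) else 0) = inclusionProb P K T.card * M := by
    intro T hT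
    rw [Finset.sum_boole, hΩ, card_filter_superset_powersetCard hKP T hT]
  have hX1 : ∑ r ∈ Ω, X r = N * p * M := by
    rw [Finset.sum_comm]
    rw [Finset.sum_congr rfl fun T hT => (hcount T (by rw [hFq T hT]; omega)).trans
      (by rw [hFq T hT])]
    rw [Finset.sum_const, nsmul_eq_mul, mul_assoc]
  have hX2 : ∑ r ∈ Ω, X r ^ 2 ≤ ((N * p) ^ 2 + N * p * (2 ^ q * Real.exp 1)) * M := by
    have e1 : ∑ r ∈ Ω, X r ^ 2 =
        ∑ T ∈ F, ∑ S ∈ F, inclusionProb P K (T ∪ S).card * M := by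
      have : ∀ r ∈ Ω, X r ^ 2 = ∑ T ∈ F, ∑ S ∈ F, if T ∪ S ⊆ r then (1 : ℝ) else 0 := by
        intro r _
        rw [sq, Finset.sum_mul_sum]
        refine Finset.sum_congr rfl fun T _ => Finset.sum_congr rfl fun S _ => ?_
        simp only [Finset.union_subset_iff, ite_and]
        split_ifs <;> simp
      rw [Finset.sum_congr rfl this, Finset.sum_comm]
      refine Finset.sum_congr rfl fun T hT => ?_
      rw [Finset.sum_comm]
      refine Finset.sum_congr rfl fun S hS => hcount _ ?_
      have := Finset.card_union_le T S
      rw [hFq T hT, hFq S hS] at this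
      omega
    -- For fixed T, disjoint S contribute at most p² each by negative correlation; an S meeting T
    -- lies in the same block, where the weighted sum over all subsets is bounded by a constant.
    have e2 : ∀ T ∈ F, ∑ S ∈ F, inclusionProb P K (T ∪ S).card ≤
        N * p ^ 2 + p * (2 ^ q * Real.exp 1) := by
      intro T hT
      obtain ⟨a, ha, hTa⟩ := Finset.mem_biUnion.1 hT
      have hTD := (Finset.mem_powersetCard.1 hTa).1
      rw [← Finset.sum_filter_add_sum_filter_not F (fun S => Disjoint T S)]
      refine add_le_add ?_ ?_
      · calc _ ≤ ∑ S ∈ F.filter (fun S => Disjoint T S), p ^ 2 := by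
              refine Finset.sum_le_sum fun S hS => ?_
              rw [Finset.mem_filter] at hS
              rw [Finset.card_union_of_disjoint hS.2, hFq T hT, hFq S hS.1, sq]
              exact inclusionProb_add_le_mul hKP (by omega)
          _ ≤ ∑ S ∈ F, p ^ 2 := Finset.sum_le_sum_of_subset_of_nonneg
              (Finset.filter_subset _ _) fun _ _ _ => by positivity
          _ = N * p ^ 2 := by rw [Finset.sum_const, nsmul_eq_mul]
      · have hsub : F.filter (fun S => ¬ Disjoint T S) ⊆ (D a).powerset := by
          intro S hS
          rw [Finset.mem_filter, Finset.not_disjoint_iff] at hS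
          obtain ⟨hSF, k, hkT, hkS⟩ := hS
          obtain ⟨b, hb, hSb⟩ := Finset.mem_biUnion.1 hSF
          have hSD := (Finset.mem_powersetCard.1 hSb).1
          have hab : a = b := by
            by_contra hab
            exact Finset.disjoint_left.1 (hdisj ha hb hab) (hTD hkT) (hSD hkS)
          subst hab
          exact Finset.mem_powerset.2 hSD
        calc _ ≤ ∑ S ∈ F.filter (fun S => ¬ Disjoint T S),
                p * ((K : ℝ) / P) ^ (S \ T).card := by
              refine Finset.sum_le_sum fun S hS => ?_
              rw [Finset.mem_filter] at hS
              have h1 : (T ∪ S).card = q + (S \ T).card := by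
                rw [← Finset.union_sdiff_self_eq_union,
                  Finset.card_union_of_disjoint Finset.disjoint_sdiff, hFq T hT]
              have h2 : (S \ T).card ≤ q := by
                rw [← hFq S hS.1]; exact Finset.card_le_card Finset.sdiff_subset
              rw [h1]
              exact inclusionProb_add_le_mul_pow hKP (by omega)
          _ ≤ ∑ S ∈ (D a).powerset, p * ((K : ℝ) / P) ^ (S \ T).card :=
              Finset.sum_le_sum_of_subset_of_nonneg hsub fun _ _ _ => by positivity
          _ = p * ∑ S ∈ (D a).powerset, ((K : ℝ) / P) ^ (S \ T).card := by
              rw [Finset.mul_sum]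
          _ ≤ p * (2 ^ q * Real.exp 1) := by
              refine mul_le_mul_of_nonneg_left ?_ hp0
              refine (sum_powerset_pow_card_sdiff_le (D a) T hx).trans ?_
              rw [hFq T hT]
              have : ((D a).card : ℝ) * (K / P) ≤ 1 :=
                (mul_le_mul_of_nonneg_right (by exact_mod_cast hD a ha) hx).trans hK2
              gcongr
    rw [e1]
    calc _ = (∑ T ∈ F, ∑ S ∈ F, inclusionProb P K (T ∪ S).card) * M := by
            simp_rw [Finset.sum_mul]
      _ ≤ (∑ T ∈ F, (N * p ^ 2 + p * (2 ^ q * Real.exp 1))) * M :=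
            mul_le_mul_of_nonneg_right (Finset.sum_le_sum e2) hM0
      _ = _ := by rw [Finset.sum_const, nsmul_eq_mul]; ring
  set Z := Ω.filter fun r => ∀ a ∈ A, (r ∩ D a).card < q with hZ
  have hXZ : ∀ r ∈ Z, X r = 0 := by
    intro r hr
    refine Finset.sum_eq_zero fun T hT => if_neg fun hTr => ?_
    obtain ⟨a, ha, hTa⟩ := Finset.mem_biUnion.1 hT
    rw [Finset.mem_powersetCard] at hTa
    have h1 := (Finset.mem_filter.1 hr).2 a ha
    have h2 := Finset.card_le_card (Finset.subset_inter hTr hTa.1)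
    omega
  -- Each ring in `Z` deviates from the mean by exactly N p.
  have hvar : (Z.card : ℝ) * (N * p) ^ 2 ≤ N * p * (2 ^ q * Real.exp 1) * M := by
    calc (Z.card : ℝ) * (N * p) ^ 2 = ∑ r ∈ Z, (X r - N * p) ^ 2 := by
          rw [Finset.sum_congr rfl fun r hr => by rw [hXZ r hr], Finset.sum_const, nsmul_eq_mul]
          ring
      _ ≤ ∑ r ∈ Ω, (X r - N * p) ^ 2 :=
          Finset.sum_le_sum_of_subset_of_nonneg (Finset.filter_subset _ _) fun _ _ _ => sq_nonneg _
      _ = ∑ r ∈ Ω, X r ^ 2 - 2 * (N * p) * ∑ r ∈ Ω, X r + Ω.card * (N * p) ^ 2 := by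
          simp only [sub_sq, Finset.sum_add_distrib, Finset.sum_sub_distrib, Finset.sum_const,
            nsmul_eq_mul, Finset.mul_sum]
          congr 2
          exact Finset.sum_congr rfl fun r _ => by ring
      _ ≤ _ := by rw [hX1, hΩcard]; linarith
  rcases (mul_nonneg hN0 hp0).eq_or_lt with h0 | h0
  · rw [← h0, mul_zero]; positivity
  · refine le_of_mul_le_mul_right ?_ h0
    linarith

end SecondMoment

/-! ### Independence, and the uniform law on key rings. -/

/-- If membership in `E` forces the coordinates in `B` into a set which is determined by the other
coordinates and has probability at most `η`, then `E` has probability at most `η ^ #B`. -/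
lemma measure_pi_le_pow_card {ι Ω : Type*} [Fintype ι] [DecidableEq ι] [Finite Ω]
    [MeasurableSpace Ω] [MeasurableSingletonClass Ω] (μ : Measure Ω) [IsProbabilityMeasure μ]
    (B : Finset ι) (E : Set (ι → Ω)) (G : (ι → Ω) → Set Ω)
    (hG : ∀ R R', (∀ i ∉ B, R i = R' i) → G R = G R')
    (hE : ∀ R ∈ E, ∀ b ∈ B, R b ∈ G R) (η : ENNReal) (hη : ∀ R ∈ E, μ (G R) ≤ η) :
    Measure.pi (fun _ => μ) E ≤ η ^ B.card := by
  have hmp := measurePreserving_piEquivPiSubtypeProd (fun _ : ι => μ) (fun i => i ∉ B)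
  set e := MeasurableEquiv.piEquivPiSubtypeProd (fun _ : ι => Ω) (fun i => i ∉ B) with he
  have hmeas : MeasurableSet (e.symm ⁻¹' E) := Set.Finite.measurableSet (Set.toFinite _)
  have h1 : Measure.pi (fun _ => μ) E = ((Measure.pi fun _ : {i // i ∉ B} => μ).prod
      (Measure.pi fun _ : {i // ¬ i ∉ B} => μ)) (e.symm ⁻¹' E) := by
    rw [← hmp.measure_preimage hmeas.nullMeasurableSet]
    congr 1
    ext R
    simp
  rw [h1, Measure.prod_apply hmeas]
  have hcard : Fintype.card {i // ¬ i ∉ B} = B.card := by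
    simp
  have h2 : ∀ x, (Measure.pi fun _ : {i // ¬ i ∉ B} => μ) (Prod.mk x ⁻¹' (e.symm ⁻¹' E)) ≤
      η ^ B.card := by
    intro x
    rcases Set.eq_empty_or_nonempty (Prod.mk x ⁻¹' (e.symm ⁻¹' E)) with h0 | ⟨y₀, hy₀⟩
    · rw [h0]; simp
    -- The coordinates off `B` are frozen at x, so `G` is constant on the slice and may be evaluated
    -- at any one of its points, here y₀.
    · have hsub : Prod.mk x ⁻¹' (e.symm ⁻¹' E) ⊆
          Set.univ.pi fun _ : {i // ¬ i ∉ B} => G (e.symm (x, y₀)) := by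
        intro y hy i _
        have hi : (i : ι) ∈ B := not_not.1 i.2
        have h3 := hE _ hy i hi
        have h4 : e.symm (x, y) i = y i := by
          simp [he, MeasurableEquiv.piEquivPiSubtypeProd, Equiv.piEquivPiSubtypeProd, hi]
        rw [← h4, hG (e.symm (x, y₀)) (e.symm (x, y))]
        · exact h3
        · intro j hj
          simp [he, MeasurableEquiv.piEquivPiSubtypeProd, Equiv.piEquivPiSubtypeProd, hj]
      refine (measure_mono hsub).trans ?_
      rw [Measure.pi_pi, Finset.prod_const, Finset.card_univ, hcard]
      exact pow_le_pow_left' (hη _ hy₀) _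
  refine (lintegral_mono h2).trans ?_
  simp

namespace KeyRing

noncomputable instance instFintype (P K : ℕ) : Fintype (KeyRing P K) :=
  inferInstanceAs (Fintype {s : Finset (Fin P) // s.card = K})

instance instMeasurableSingletonClass (P K : ℕ) : MeasurableSingletonClass (KeyRing P K) :=
  ⟨fun _ => trivial⟩

variable {P K : ℕ}

lemma card_keys (r : KeyRing P K) : r.keys.card = K := r.2

lemma nonempty_of_le (h : K ≤ P) : Nonempty (KeyRing P K) := by
  obtain ⟨s, -, hs⟩ := Finset.exists_subset_card_eq
    (s := (Finset.univ : Finset (Fin P))) (n := K) (by simpa using h)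
  exact ⟨⟨s, hs⟩⟩

lemma card_filter_keys (p : Finset (Fin P) → Prop) [DecidablePred p] :
    ((Finset.univ : Finset (KeyRing P K)).filter fun r => p r.keys).card =
      (((Finset.univ : Finset (Fin P)).powersetCard K).filter p).card := by
  refine Finset.card_bij (fun r _ => r.keys) ?_ ?_ ?_
  · intro r hr
    simpa [r.card_keys] using hr
  · intro r _ r' _ h
    exact Subtype.ext h
  · intro s hs
    simp only [Finset.mem_filter, Finset.mem_powersetCard] at hs
    exact ⟨⟨s, hs.1.2⟩, Finset.mem_filter.2 ⟨Finset.mem_univ _, hs.2⟩, rfl⟩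

lemma card_keyRing : Fintype.card (KeyRing P K) = P.choose K := by
  have h := card_filter_keys (P := P) (K := K) fun _ => True
  simpa using h

lemma uniformOn_le_ofReal (h : K ≤ P) (p : Finset (Fin P) → Prop) [DecidablePred p] {x : ℝ}
    (hp : ((((Finset.univ : Finset (Fin P)).powersetCard K).filter p).card : ℝ) ≤
      x * P.choose K) :
    uniformOn (Set.univ : Set (KeyRing P K)) {r | p r.keys} ≤ ENNReal.ofReal x := by
  have hpos : (0 : ℝ) < P.choose K := by exact_mod_cast Nat.choose_pos h
  have e : {r : KeyRing P K | p r.keys} =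
      ((Finset.univ : Finset (KeyRing P K)).filter fun r => p r.keys : Finset _) := by
    ext; simp
  rw [uniformOn_univ, e, Measure.count_apply_finset, card_filter_keys, card_keyRing,
    ← ENNReal.ofReal_natCast, ← ENNReal.ofReal_natCast, ← ENNReal.ofReal_div_of_pos hpos]
  exact ENNReal.ofReal_le_ofReal ((div_le_iff₀ hpos).2 hp)

end KeyRing

lemma keyLaw_isProbabilityMeasure {n P K : ℕ} (h : K ≤ P) :
    IsProbabilityMeasure (keyLaw n P K) := by
  have := KeyRing.nonempty_of_le h
  unfold keyLaw
  infer_instance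

/-! ### Private keys and missed links. -/

section Events

variable {n P K : ℕ}

lemma card_compromisedKeys_le (R : KeyAssignment n P K) (S : Finset (Fin n)) :
    (compromisedKeys R S).card ≤ S.card * K :=
  Finset.card_biUnion_le_card_mul _ _ _ fun i _ => (R i).card_keys.le

lemma compromisedKeys_mono (R : KeyAssignment n P K) {S T : Finset (Fin n)} (h : S ⊆ T) :
    compromisedKeys R S ⊆ compromisedKeys R T :=
  Finset.biUnion_subset_biUnion_of_subset_left _ h

lemma compromisedKeys_congr {R R' : KeyAssignment n P K} {S : Finset (Fin n)}
    (h : ∀ i ∈ S, R i = R' i) : compromisedKeys R S = compromisedKeys R' S :=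
  Finset.biUnion_congr rfl fun i hi => by rw [h i hi]

/-- At least half of the keys of sensor `i` are held by no other sensor. -/
def HasManyPrivateKeys (R : KeyAssignment n P K) (i : Fin n) : Prop :=
  K ≤ 2 * ((R i).keys \ compromisedKeys R (Finset.univ.erase i)).card

/-- The other rings cover at most nK keys. The tail bound with x = exp 8 and t ≥ K/2 has exponent at
most K - 8·K/2 = -3K. -/
lemma keyLaw_not_hasManyPrivateKeys_le (hKP : K ≤ P)
    (hsparse : Real.exp 8 * (n * (K / P)) ≤ 1) (i : Fin n) :
    keyLaw n P K {R | ¬ HasManyPrivateKeys R i} ≤ ENNReal.ofReal (Real.exp (-(3 * K))) := by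
  have := KeyRing.nonempty_of_le hKP
  have h := measure_pi_le_pow_card (uniformOn (Set.univ : Set (KeyRing P K))) {i}
    {R : KeyAssignment n P K | ¬ HasManyPrivateKeys R i}
    (fun R => {r | (K + 1) / 2 ≤ (r.keys ∩ compromisedKeys R (Finset.univ.erase i)).card})
    ?_ ?_ (ENNReal.ofReal (Real.exp (-(3 * K)))) ?_
  · simpa [keyLaw] using h
  · intro R R' h
    rw [compromisedKeys_congr (R := R) (R' := R')]
    intro j hj
    exact h j (by simpa using hj)
  · intro R hR b hb
    obtain rfl := Finset.mem_singleton.1 hb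
    have h1 := Finset.card_inter_add_card_sdiff (R b).keys
      (compromisedKeys R (Finset.univ.erase b))
    rw [(R b).card_keys] at h1
    simp only [HasManyPrivateKeys, Set.mem_ofPred_eq, not_le] at hR ⊢
    omega
  · intro R _
    refine KeyRing.uniformOn_le_ofReal hKP
      (fun r => (K + 1) / 2 ≤ (r ∩ compromisedKeys R (Finset.univ.erase i)).card) ?_
    refine (card_filter_le_inter_le hKP _ (by omega) (Real.exp_pos 8)).trans ?_
    refine mul_le_mul_of_nonneg_right ?_ (by positivity)
    rw [← Real.exp_nat_mul, ← Real.exp_sub]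
    refine Real.exp_le_exp.2 ?_
    have h1 : ((compromisedKeys R (Finset.univ.erase i)).card : ℝ) ≤ n * K := by
      have h2 := card_compromisedKeys_le R (Finset.univ.erase i)
      have h3 : (Finset.univ.erase i).card ≤ n := by
        simp
      exact_mod_cast h2.trans (Nat.mul_le_mul_right K h3)
    have h4 : Real.exp 8 * ((compromisedKeys R (Finset.univ.erase i)).card * (K / P)) ≤ K := by
      calc _ ≤ Real.exp 8 * ((n * K) * (K / P)) := by gcongr
        _ = (Real.exp 8 * (n * (K / P))) * K := by ring
        _ ≤ 1 * K := by gcongr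
        _ = K := one_mul _
    have h5 : (K : ℝ) ≤ 2 * ((K + 1) / 2 : ℕ) := by
      exact_mod_cast (by omega : K ≤ 2 * ((K + 1) / 2))
    linarith

/-- The keys of sensor `a` that no other sensor outside `B` holds. -/
def keysPrivateOff (R : KeyAssignment n P K) (B : Finset (Fin n)) (a : Fin n) :
    Finset (Fin P) :=
  (R a).keys \ compromisedKeys R (Bᶜ.erase a)

lemma keysPrivateOff_congr {R R' : KeyAssignment n P K} {B : Finset (Fin n)}
    (h : ∀ i ∉ B, R i = R' i) {a : Fin n} (ha : a ∉ B) :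
    keysPrivateOff R B a = keysPrivateOff R' B a := by
  rw [keysPrivateOff, keysPrivateOff, h a ha, compromisedKeys_congr]
  intro i hi
  exact h i (by simpa using Finset.mem_of_mem_erase hi)

lemma pairwiseDisjoint_keysPrivateOff (R : KeyAssignment n P K) {A B : Finset (Fin n)}
    (hAB : Disjoint A B) : (A : Set (Fin n)).PairwiseDisjoint (keysPrivateOff R B) := by
  intro a ha b hb hab
  rw [Function.onFun, Finset.disjoint_left]
  intro k hka hkb
  refine (Finset.mem_sdiff.1 hkb).2 (Finset.mem_biUnion.2 ⟨a, ?_, (Finset.mem_sdiff.1 hka).1⟩)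
  simp [hab, Finset.disjoint_left.1 hAB ha]

/-- The sensors of `A` have many private keys off `B`, but no sensor of `B` holds `q` of those of
the same sensor of `A`. -/
def NoPrivateLink (q : ℕ) (R : KeyAssignment n P K) (A B : Finset (Fin n)) : Prop :=
  (∀ a ∈ A, K ≤ 2 * (keysPrivateOff R B a).card) ∧
    ∀ b ∈ B, ∀ a ∈ A, ((R b).keys ∩ keysPrivateOff R B a).card < q

/-- The private parts depend only on the rings off `B`, so each ring of `B` faces the same fixed
disjoint blocks and misses them with probability at most η. The factor 8⁻¹ is 1/4 from the binomial
coefficients times 1/2 from the inclusion probability. -/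
lemma keyLaw_noPrivateLink_le {q : ℕ} (hq : 1 ≤ q) (hqK : 4 * q ≤ K) (hKP : K ≤ P)
    (hK2 : (K : ℝ) * (K / P) ≤ 1) {A B : Finset (Fin n)} (hAB : Disjoint A B) {η : ℝ}
    (hη : 2 ^ q * Real.exp 1 ≤
      η * (A.card * (8⁻¹ ^ q * (1 / (q.factorial : ℝ) * ((K : ℝ) ^ (2 * q) / (P : ℝ) ^ q))))) :
    keyLaw n P K {R | NoPrivateLink q R A B} ≤ ENNReal.ofReal η ^ B.card := by
  have := KeyRing.nonempty_of_le hKP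
  have hη0 : 0 ≤ η := by
    by_contra h
    have h1 : (0 : ℝ) < 2 ^ q * Real.exp 1 := by positivity
    have h2 := mul_nonpos_of_nonpos_of_nonneg (not_le.1 h).le (by positivity :
      0 ≤ (A.card * (8⁻¹ ^ q * (1 / (q.factorial : ℝ) * ((K : ℝ) ^ (2 * q) / (P : ℝ) ^ q)))))
    linarith
  refine measure_pi_le_pow_card (uniformOn (Set.univ : Set (KeyRing P K))) B _
    (fun R => {r | ∀ a ∈ A, (r.keys ∩ keysPrivateOff R B a).card < q}) ?_ ?_ _ ?_
  · intro R R' h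
    ext r
    refine forall₂_congr fun a ha => ?_
    rw [keysPrivateOff_congr h (Finset.disjoint_left.1 hAB ha)]
  · intro R hR b hb
    exact hR.2 b hb
  · intro R hR
    refine KeyRing.uniformOn_le_ofReal hKP
      (fun r => ∀ a ∈ A, (r ∩ keysPrivateOff R B a).card < q) ?_
    have h1 := card_filter_forall_inter_lt_mul_le hq (by omega) hKP hK2 A
      (keysPrivateOff R B) (pairwiseDisjoint_keysPrivateOff R hAB) fun a _ =>
        (Finset.card_le_card Finset.sdiff_subset).trans (R a).card_keys.le
    have hqK' : 4 * (q : ℝ) ≤ K := by exact_mod_cast hqK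
    have hP : (0 : ℝ) < P := by exact_mod_cast (by omega : 0 < P)
    have hch : ∀ a ∈ A, ((K : ℝ) / 4) ^ q / q.factorial ≤
        ((keysPrivateOff R B a).card.choose q : ℝ) := by
      intro a ha
      refine le_trans ?_ (Nat.pow_le_choose q _)
      have h2 := hR.1 a ha
      -- At least K/2 keys are private and q ≤ K/4.
      have h3 : (K : ℝ) / 4 ≤ ((keysPrivateOff R B a).card + 1 - q : ℕ) := by
        rw [div_le_iff₀ (by norm_num)]
        exact_mod_cast (by omega : K ≤ ((keysPrivateOff R B a).card + 1 - q) * 4)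
      gcongr
    have hpq : ((K : ℝ) / 2 / P) ^ q ≤ inclusionProb P K q := by
      refine le_trans ?_ (pow_le_inclusionProb hKP (by omega))
      gcongr
      linarith
    have hN : A.card * (8⁻¹ ^ q * (1 / (q.factorial : ℝ) * ((K : ℝ) ^ (2 * q) / (P : ℝ) ^ q))) ≤
        (∑ a ∈ A, ((keysPrivateOff R B a).card.choose q : ℝ)) * inclusionProb P K q := by
      calc _ = (∑ a ∈ A, ((K : ℝ) / 4) ^ q / q.factorial) * ((K : ℝ) / 2 / P) ^ q := by
            have e : ((K : ℝ) / 4) ^ q * ((K : ℝ) / 2 / P) ^ q =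
                8⁻¹ ^ q * ((K : ℝ) ^ (2 * q) / (P : ℝ) ^ q) := by
              rw [← mul_pow, pow_mul, ← div_pow, ← mul_pow]
              ring
            rw [Finset.sum_const, nsmul_eq_mul, mul_assoc, div_mul_eq_mul_div _ _ (_ ^ q), e]
            ring
        _ ≤ _ := mul_le_mul (Finset.sum_le_sum hch) hpq (by positivity)
            (Finset.sum_nonneg fun _ _ => by positivity)
    set N := (∑ a ∈ A, ((keysPrivateOff R B a).card.choose q : ℝ)) * inclusionProb P K q
    have hηN : 2 ^ q * Real.exp 1 ≤ η * N := hη.trans (mul_le_mul_of_nonneg_left hN hη0)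
    have hN0 : 0 < N := by
      by_contra h
      have h2 : (0 : ℝ) < 2 ^ q * Real.exp 1 := by positivity
      have := mul_nonpos_of_nonneg_of_nonpos hη0 (not_lt.1 h)
      linarith
    refine le_of_mul_le_mul_right (le_trans (le_of_eq (by congr!)) (h1.trans ?_)) hN0
    rw [mul_right_comm η]
    exact mul_le_mul_of_nonneg_right hηN (Nat.cast_nonneg _)

end Events

/-! ### From links between large sets to a large connected set. -/

/-- If all large disjoint subsets of `W` are linked, then `W` contains a connected set missing only
few vertices of `W`. -/
lemma exists_connected_of_forall_exists_adj {V : Type*} [DecidableEq V] (G : SimpleGraph V)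
    (W : Finset V) {e : ℝ} (he : 0 < e) (hW : 3 * e ≤ W.card)
    (hadj : ∀ A ⊆ W, ∀ B ⊆ W, Disjoint A B → e ≤ A.card → e ≤ B.card →
      ∃ a ∈ A, ∃ b ∈ B, G.Adj a b) :
    ∃ T ⊆ W, (W.card : ℝ) - e ≤ T.card ∧ (G.induce (T : Set V)).Connected := by
  classical
  -- Sets closed under adjacency within `W` and of size at least e. A smallest one, U, omits fewer
  -- than e vertices of `W`, so |U| > 2e. If U were disconnected, it would be the union of two
  -- smaller closed sets, each of size below e by minimality.
  let C : Finset (Finset V) := W.powerset.filter fun U =>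
    (∀ u ∈ U, ∀ w ∈ W, G.Adj u w → w ∈ U) ∧ e ≤ U.card
  have hC : C.Nonempty := ⟨W, by
    simp only [C, Finset.mem_filter, Finset.mem_powerset]
    exact ⟨subset_rfl, fun _ _ w hw _ => hw, by linarith⟩⟩
  obtain ⟨U, hU, hmin⟩ := Finset.exists_min_image C Finset.card hC
  obtain ⟨hUW, hclosed, heU⟩ : U ⊆ W ∧ (∀ u ∈ U, ∀ w ∈ W, G.Adj u w → w ∈ U) ∧ e ≤ U.card := by
    simpa [C] using hU
  have hWU : ((W \ U).card : ℝ) < e := by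
    by_contra! h
    obtain ⟨a, ha, b, hb, hab⟩ := hadj U hUW (W \ U) Finset.sdiff_subset
      Finset.disjoint_sdiff heU h
    rw [Finset.mem_sdiff] at hb
    exact hb.2 (hclosed a ha b hb.1 hab)
  have hcard : (W.card : ℝ) = (W \ U).card + U.card := by
    exact_mod_cast (Finset.card_sdiff_add_card_eq_card hUW).symm
  refine ⟨U, hUW, by linarith, ?_⟩
  have hne : U.Nonempty := Finset.card_pos.1 (by exact_mod_cast he.trans_le heU)
  have : Nonempty (U : Set V) := hne.to_subtype
  refine ⟨?_⟩
  rintro ⟨u, hu⟩ ⟨v, hv⟩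
  by_contra hnr
  let X := U.filter fun x => ∃ hx : x ∈ (U : Set V), (G.induce (U : Set V)).Reachable ⟨u, hu⟩ ⟨x, hx⟩
  have hXU : X ⊆ U := Finset.filter_subset _ _
  have huX : u ∈ X := Finset.mem_filter.2 ⟨hu, hu, SimpleGraph.Reachable.refl _⟩
  have hvX : v ∉ X := fun h => hnr (Finset.mem_filter.1 h).2.2
  have hstep : ∀ x ∈ X, ∀ y ∈ U, G.Adj x y → y ∈ X := by
    intro x hx y hy hxy
    obtain ⟨-, hxU, hr⟩ := Finset.mem_filter.1 hx
    refine Finset.mem_filter.2 ⟨hy, hy, hr.trans (SimpleGraph.Adj.reachable ?_)⟩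
    exact hxy
  have hsmall : ∀ Y ⊂ U, (∀ x ∈ Y, ∀ w ∈ W, G.Adj x w → w ∈ Y) → (Y.card : ℝ) < e := by
    intro Y hYU hY
    by_contra! h
    have := hmin Y (Finset.mem_filter.2 ⟨Finset.mem_powerset.2 (hYU.subset.trans hUW), hY, h⟩)
    exact absurd (Finset.card_lt_card hYU) (by omega)
  have h1 := hsmall X (Finset.ssubset_iff_subset_ne.2 ⟨hXU, fun h => hvX (h ▸ hv)⟩)
    fun x hx w hw hxw => hstep x hx w (hclosed x (hXU hx) w hw hxw) hxw
  have h2 := hsmall (U \ X)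
    (Finset.ssubset_iff_subset_ne.2 ⟨Finset.sdiff_subset, fun h => by
      rw [← h] at hu; exact (Finset.mem_sdiff.1 hu).2 huX⟩)
    fun x hx w hw hxw => by
      rw [Finset.mem_sdiff] at hx ⊢
      exact ⟨hclosed x hx.1 w hw hxw, fun hwX => hx.2 (hstep w hwX x hx.1 hxw.symm)⟩
  have h3 : (U.card : ℝ) = (U \ X).card + X.card := by
    exact_mod_cast (Finset.card_sdiff_add_card_eq_card hXU).symm
  linarith

/-! ### Sequences of events with high probability. -/

section WithHighProbability

variable {K P : ℕ → ℕ}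

lemma WithHighProbability.mono (hKP : ∀ᶠ n in atTop, K n ≤ P n)
    {E F : ∀ n, KeyAssignment n (P n) (K n) → Prop} (hE : WithHighProbability K P E)
    (h : ∀ᶠ n in atTop, ∀ R, E n R → F n R) : WithHighProbability K P F := by
  refine tendsto_of_tendsto_of_tendsto_of_le_of_le' hE tendsto_const_nhds ?_ ?_
  · filter_upwards [h] with n hn using measure_mono fun R hR => hn R hR
  · filter_upwards [hKP] with n hn
    have := keyLaw_isProbabilityMeasure (n := n) hn
    exact prob_le_one

lemma withHighProbability_of_tendsto_compl (hKP : ∀ᶠ n in atTop, K n ≤ P n)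
    {E : ∀ n, KeyAssignment n (P n) (K n) → Prop}
    (h : Tendsto (fun n => keyLaw n (P n) (K n) {R | ¬ E n R}) atTop (𝓝 0)) :
    WithHighProbability K P E := by
  have h1 : Tendsto (fun n => 1 - keyLaw n (P n) (K n) {R | ¬ E n R}) atTop (𝓝 (1 - 0)) :=
    ENNReal.Tendsto.sub tendsto_const_nhds h (Or.inl ENNReal.one_ne_top)
  rw [tsub_zero] at h1
  refine h1.congr' ?_
  filter_upwards [hKP] with n hn
  have := keyLaw_isProbabilityMeasure (n := n) hn
  rw [← prob_compl_eq_one_sub (Set.Finite.measurableSet (Set.toFinite _))]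
  congr 1
  ext R
  simp

/-- Diagonal argument: countably many sequences of events holding with high probability can be
traversed slowly. -/
lemma exists_tendsto_withHighProbability (hKP : ∀ᶠ n in atTop, K n ≤ P n)
    {E : ℕ → ∀ n, KeyAssignment n (P n) (K n) → Prop} (hE : ∀ k, WithHighProbability K P (E k)) :
    ∃ φ : ℕ → ℕ, Tendsto φ atTop atTop ∧ WithHighProbability K P fun n => E (φ n) n := by
  classical
  let Q : ℕ → ℕ → Prop := fun n k =>
    1 - ((k : ENNReal) + 1)⁻¹ ≤ keyLaw n (P n) (K n) {R | E k n R}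
  let φ : ℕ → ℕ := fun n => Nat.findGreatest (Q n) n
  have hφ : Tendsto φ atTop atTop := by
    refine tendsto_atTop.2 fun k => ?_
    have h1 : 1 - ((k : ENNReal) + 1)⁻¹ < 1 :=
      ENNReal.sub_lt_self ENNReal.one_ne_top one_ne_zero (by simp)
    filter_upwards [(hE k).eventually (eventually_gt_nhds h1), eventually_ge_atTop k] with n hn hk
    exact Nat.le_findGreatest hk hn.le
  -- At k = 0 the threshold is 1 - 1 = 0, so the search always succeeds.
  have hQ : ∀ n, Q n (φ n) := fun n =>
    Nat.findGreatest_spec (P := Q n) (Nat.zero_le n) (by simp [Q])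
  refine ⟨φ, hφ, ?_⟩
  have h2 : Tendsto (fun k : ℕ => 1 - ((k : ENNReal) + 1)⁻¹) atTop (𝓝 1) := by
    have h3 : Tendsto (fun k : ℕ => ((k : ENNReal) + 1)⁻¹) atTop (𝓝 0) := by
      have := (tendsto_add_atTop_iff_nat 1).2 ENNReal.tendsto_inv_nat_nhds_zero
      simpa using this
    simpa using ENNReal.Tendsto.sub (tendsto_const_nhds (x := (1 : ENNReal))) h3
      (Or.inl ENNReal.one_ne_top)
  refine tendsto_of_tendsto_of_tendsto_of_le_of_le' (h2.comp hφ) tendsto_const_nhds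
    (Eventually.of_forall hQ) ?_
  filter_upwards [hKP] with n hn
  have := keyLaw_isProbabilityMeasure (n := n) hn
  exact prob_le_one

end WithHighProbability

/-! ### The key event and its consequences. -/

section Chunks

variable {n P K : ℕ}

/-- Any two disjoint sets of at least `ε n` sensors contain a pair of sensors sharing `q` keys which
no sensor outside the two sets holds. -/
def LargeChunksLinked (q : ℕ) (ε : ℝ) (R : KeyAssignment n P K) : Prop :=
  ∀ A B : Finset (Fin n), Disjoint A B → ε * n ≤ A.card → ε * n ≤ B.card →
    ∃ a ∈ A, ∃ b ∈ B, q ≤ (sharedKeys R a b \ compromisedKeys R (A ∪ B)ᶜ).card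

/-- Keys private among all sensors are private off B. A key of b that is private to a off B is
shared by both and absent from all rings outside A ∪ B, so q of them would give the missing link. -/
lemma exists_noPrivateLink {q : ℕ} {ε : ℝ} {R : KeyAssignment n P K}
    (hpriv : ∀ i, HasManyPrivateKeys R i) (h : ¬ LargeChunksLinked q ε R) :
    ∃ A B : Finset (Fin n), Disjoint A B ∧ ε * n ≤ A.card ∧ ε * n ≤ B.card ∧
      NoPrivateLink q R A B := by
  simp only [LargeChunksLinked] at h
  push Not at h
  obtain ⟨A, B, hAB, hA, hB, h⟩ := h
  refine ⟨A, B, hAB, hA, hB, fun a _ => ?_, fun b hb a ha => ?_⟩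
  · refine (hpriv a).trans (Nat.mul_le_mul_left 2 (Finset.card_le_card ?_))
    exact Finset.sdiff_subset_sdiff subset_rfl
      (compromisedKeys_mono R (Finset.erase_subset_erase _ (Finset.subset_univ _)))
  · refine lt_of_le_of_lt (Finset.card_le_card ?_) (h a ha b hb)
    intro k hk
    rw [Finset.mem_inter, keysPrivateOff, Finset.mem_sdiff] at hk
    refine Finset.mem_sdiff.2 ⟨Finset.mem_inter.2 ⟨hk.2.1, hk.1⟩, fun hk' => hk.2.2 ?_⟩
    refine compromisedKeys_mono R (fun i hi => ?_) hk'
    simp only [Finset.mem_compl, Finset.mem_union, not_or, Finset.mem_erase] at hi ⊢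
    exact ⟨fun hia => hi.1 (hia ▸ ha), hi.2⟩

/-- Two union bounds: over sensors, n exp(-3K) ≤ exp(-2K); over pairs (A, B), 4^n exp(-3n) ≤
exp(-n), since 4 ≤ exp 2. -/
lemma keyLaw_not_largeChunksLinked_le {q : ℕ} (hq : 1 ≤ q) (hqK : 4 * q ≤ K) (hKP : K ≤ P)
    (hK2 : (K : ℝ) * (K / P) ≤ 1) (hsparse : Real.exp 8 * (n * (K / P)) ≤ 1)
    (hnK : (n : ℝ) ≤ Real.exp K) {ε : ℝ} (hε : 0 < ε)
    (hη : 2 ^ q * Real.exp 1 ≤ Real.exp (-(3 / ε)) *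
      (ε * n * (8⁻¹ ^ q * (1 / (q.factorial : ℝ) * ((K : ℝ) ^ (2 * q) / (P : ℝ) ^ q))))) :
    keyLaw n P K {R | ¬ LargeChunksLinked q ε R} ≤
      ENNReal.ofReal (Real.exp (-K) + Real.exp (-n)) := by
  classical
  let I : Finset (Finset (Fin n) × Finset (Fin n)) := Finset.univ.filter fun p =>
    Disjoint p.1 p.2 ∧ ε * n ≤ p.1.card ∧ ε * n ≤ p.2.card
  have hsub : {R : KeyAssignment n P K | ¬ LargeChunksLinked q ε R} ⊆
      (⋃ i ∈ (Finset.univ : Finset (Fin n)), {R | ¬ HasManyPrivateKeys R i}) ∪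
        ⋃ p ∈ I, {R | NoPrivateLink q R p.1 p.2} := by
    intro R hR
    by_cases hpriv : ∀ i, HasManyPrivateKeys R i
    · obtain ⟨A, B, hAB, hA, hB, h⟩ := exists_noPrivateLink hpriv hR
      refine Or.inr (Set.mem_biUnion (x := (A, B)) ?_ h)
      simpa [I] using ⟨hAB, hA, hB⟩
    · obtain ⟨i, hi⟩ := not_forall.1 hpriv
      exact Or.inl (Set.mem_biUnion (x := i) (by simp) hi)
  have h1 : keyLaw n P K (⋃ i ∈ (Finset.univ : Finset (Fin n)), {R | ¬ HasManyPrivateKeys R i}) ≤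
      ENNReal.ofReal (Real.exp (-K)) := by
    refine (measure_biUnion_finset_le _ _).trans ((Finset.sum_le_sum fun i _ =>
      keyLaw_not_hasManyPrivateKeys_le hKP hsparse i).trans ?_)
    rw [Finset.sum_const, Finset.card_univ, Fintype.card_fin, nsmul_eq_mul,
      ← ENNReal.ofReal_natCast, ← ENNReal.ofReal_mul (by positivity)]
    refine ENNReal.ofReal_le_ofReal ?_
    calc (n : ℝ) * Real.exp (-(3 * K)) ≤ Real.exp K * Real.exp (-(3 * K)) := by gcongr
      _ = Real.exp (-(2 * K)) := by rw [← Real.exp_add]; ring_nf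
      _ ≤ Real.exp (-K) := Real.exp_le_exp.2 (by linarith [(Nat.cast_nonneg K : (0 : ℝ) ≤ K)])
  have h2 : keyLaw n P K (⋃ p ∈ I, {R | NoPrivateLink q R p.1 p.2}) ≤
      ENNReal.ofReal (Real.exp (-n)) := by
    have h3 : ∀ p ∈ I, keyLaw n P K {R | NoPrivateLink q R p.1 p.2} ≤
        ENNReal.ofReal (Real.exp (-(3 * n))) := by
      intro p hp
      obtain ⟨hd, hA, hB⟩ := (Finset.mem_filter.1 hp).2
      refine (keyLaw_noPrivateLink_le hq hqK hKP hK2 hd (η := Real.exp (-(3 / ε)))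
        (hη.trans (by gcongr))).trans ?_
      rw [← ENNReal.ofReal_pow (Real.exp_pos _).le, ← Real.exp_nat_mul]
      refine ENNReal.ofReal_le_ofReal (Real.exp_le_exp.2 ?_)
      have h4 : ε * n * (3 / ε) ≤ p.2.card * (3 / ε) := by gcongr
      have h5 : ε * n * (3 / ε) = 3 * n := by field_simp
      linarith
    refine (measure_biUnion_finset_le _ _).trans ((Finset.sum_le_sum h3).trans ?_)
    rw [Finset.sum_const, nsmul_eq_mul, ← ENNReal.ofReal_natCast,
      ← ENNReal.ofReal_mul (by positivity)]
    refine ENNReal.ofReal_le_ofReal ?_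
    have hI : (I.card : ℝ) ≤ Real.exp (2 * n) := by
      have h4 : I.card ≤ 4 ^ n := by
        refine (Finset.card_le_univ I).trans ?_
        simp [← mul_pow]
      have h5 : (4 : ℝ) ≤ Real.exp 2 := by
        have := Real.add_one_le_exp (1 : ℝ)
        rw [show (2 : ℝ) = 1 + 1 by norm_num, Real.exp_add]
        nlinarith
      calc (I.card : ℝ) ≤ 4 ^ n := by exact_mod_cast h4
        _ ≤ Real.exp 2 ^ n := by gcongr
        _ = Real.exp (2 * n) := by rw [← Real.exp_nat_mul, mul_comm]
    calc (I.card : ℝ) * Real.exp (-(3 * n)) ≤ Real.exp (2 * n) * Real.exp (-(3 * n)) := by gcongr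
      _ = Real.exp (-n) := by rw [← Real.exp_add]; ring_nf
  rw [ENNReal.ofReal_add (Real.exp_pos _).le (Real.exp_pos _).le]
  exact (measure_mono hsub).trans ((measure_union_le _ _).trans (add_le_add h1 h2))

lemma LargeChunksLinked.not_splitsInto {q : ℕ} (hq : 1 ≤ q) {ε : ℝ} {R : KeyAssignment n P K}
    (h : LargeChunksLinked q ε R) {S A B : Finset (Fin n)} (hA : ε * n ≤ A.card)
    (hB : ε * n ≤ B.card) : ¬ SplitsInto q R S A B := by
  rintro ⟨hd, hS, hsplit⟩
  obtain ⟨a, ha, b, hb, hab⟩ := h A B hd hA hB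
  -- The sensors outside A ∪ B are exactly those of S, so the q keys found are uncompromised.
  rw [hS, compl_compl] at hab
  have hne : a ≠ b := fun e => Finset.disjoint_left.1 hd ha (e ▸ hb)
  have hsub := hsplit a ha b hb ⟨hne, hab.trans (Finset.card_le_card Finset.sdiff_subset)⟩
  rw [Finset.sdiff_eq_empty_iff_subset.2 hsub, Finset.card_empty] at hab
  omega

lemma LargeChunksLinked.exists_connected {q : ℕ} {ε : ℝ} (hε : 0 < ε * n)
    {R : KeyAssignment n P K} (h : LargeChunksLinked q ε R) {S : Finset (Fin n)}
    (hS : 3 * (ε * n) ≤ n - S.card) :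
    ∃ T : Finset (Fin n), Disjoint T S ∧ (n : ℝ) - (S.card + ε * n) ≤ T.card ∧
      ((uncompromisedNetwork q R S).induce (T : Set (Fin n))).Connected := by
  have hcard : (Sᶜ.card : ℝ) = n - S.card := by
    rw [Finset.card_compl, Nat.cast_sub (Finset.card_le_univ S), Fintype.card_fin]
  obtain ⟨T, hT, hTc, hconn⟩ := exists_connected_of_forall_exists_adj
    (uncompromisedNetwork q R S) Sᶜ hε (by rw [hcard]; exact hS) (by
      intro A hAS B hBS hd hA hB
      obtain ⟨a, ha, b, hb, hab⟩ := h A B hd hA hB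
      refine ⟨a, ha, b, hb, fun e => Finset.disjoint_left.1 hd ha (e ▸ hb), hab.trans ?_⟩
      -- Here A ∪ B need not exhaust the complement of S; S ⊆ (A ∪ B)ᶜ suffices.
      refine Finset.card_le_card (Finset.sdiff_subset_sdiff subset_rfl (compromisedKeys_mono R ?_))
      rw [Finset.subset_compl_comm]
      exact Finset.union_subset hAS hBS)
  refine ⟨T, ?_, by rw [hcard] at hTc; linarith, hconn⟩
  rw [Finset.disjoint_left]
  exact fun x hx => Finset.mem_compl.1 (hT hx)

end Chunks

/-! ### Asymptotics and conclusion. -/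

theorem withHighProbability_largeChunksLinked {q : ℕ} (hq : 1 ≤ q) {K P : ℕ → ℕ}
    (hKP : ∀ᶠ n in atTop, K n ≤ P n) {c : ℝ} (hc : 0 < c)
    (hedge : ∀ᶠ n : ℕ in atTop,
      c * Real.log n / n ≤ 1 / (q.factorial : ℝ) * ((K n : ℝ) ^ (2 * q) / (P n : ℝ) ^ q))
    (hKlog : Tendsto (fun n : ℕ => (K n : ℝ) / Real.log n) atTop atTop)
    (hKo : (fun n => (K n : ℝ)) =o[atTop]
      (fun n : ℕ => min (Real.sqrt (P n)) ((P n : ℝ) / n))) {ε : ℝ} (hε : 0 < ε) :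
    WithHighProbability K P fun _ R => LargeChunksLinked q ε R := by
  have hlog : Tendsto (fun n : ℕ => Real.log n) atTop atTop :=
    Real.tendsto_log_atTop.comp tendsto_natCast_atTop_atTop
  have hKge : ∀ᶠ n : ℕ in atTop, Real.log n ≤ K n := by
    filter_upwards [hKlog.eventually_ge_atTop 1, hlog.eventually_gt_atTop 0] with n h1 h2
    rwa [le_div_iff₀ h2, one_mul] at h1
  have hKtop : Tendsto (fun n => (K n : ℝ)) atTop atTop := tendsto_atTop_mono' _ hKge hlog
  have hbound : ∀ δ : ℝ, 0 < δ → ∀ᶠ n : ℕ in atTop,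
      (K n : ℝ) ≤ δ * min (Real.sqrt (P n)) ((P n : ℝ) / n) := by
    intro δ hδ
    filter_upwards [hKo.bound hδ] with n hn
    rwa [Real.norm_of_nonneg (by positivity), Real.norm_of_nonneg (by positivity)] at hn
  refine withHighProbability_of_tendsto_compl hKP ?_
  have hlim : Tendsto (fun n : ℕ => ENNReal.ofReal (Real.exp (-K n) + Real.exp (-n))) atTop
      (𝓝 0) := by
    have h1 := (Real.tendsto_exp_neg_atTop_nhds_zero.comp hKtop).add
      (Real.tendsto_exp_neg_atTop_nhds_zero.comp (tendsto_natCast_atTop_atTop (R := ℝ)))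
    simpa using ENNReal.tendsto_ofReal h1
  refine tendsto_of_tendsto_of_tendsto_of_le_of_le' tendsto_const_nhds hlim
    (Eventually.of_forall fun _ => zero_le) ?_
  -- This constant times log n bounds from below the right side required for η = exp(-3/ε), so it
  -- eventually exceeds 2^q e for any c > 0.
  have hη0 : 0 < Real.exp (-(3 / ε)) * (ε * (8⁻¹ ^ q * c)) := by positivity
  filter_upwards [hKP, hedge, hKge, hKtop.eventually_ge_atTop ((4 * q : ℕ) : ℝ), hbound 1 one_pos,
    hbound (Real.exp (-8)) (Real.exp_pos _), eventually_gt_atTop 0,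
    (hlog.const_mul_atTop hη0).eventually_ge_atTop (2 ^ q * Real.exp 1)]
    with n hn he hKn hqK hb1 hb2 hn0 hη
  have hn0' : (0 : ℝ) < n := by exact_mod_cast hn0
  have hqK' : 4 * q ≤ K n := by exact_mod_cast hqK
  have hP : (0 : ℝ) < P n := by exact_mod_cast (by omega : 0 < P n)
  refine keyLaw_not_largeChunksLinked_le hq hqK' hn ?_ ?_ ?_ hε ?_
  · have h1 : (K n : ℝ) ≤ Real.sqrt (P n) := by
      rw [one_mul] at hb1; exact hb1.trans (min_le_left _ _)
    rw [← mul_div_assoc, div_le_one hP, ← Real.mul_self_sqrt hP.le]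
    gcongr
  · have h1 : (K n : ℝ) ≤ Real.exp (-8) * (P n / n) :=
      hb2.trans (mul_le_mul_of_nonneg_left (min_le_right _ _) (Real.exp_pos _).le)
    calc Real.exp 8 * (n * ((K n : ℝ) / P n))
        ≤ Real.exp 8 * (n * ((Real.exp (-8) * (P n / n)) / P n)) := by gcongr
      _ = Real.exp 8 * Real.exp (-8) := by field_simp
      _ = 1 := by rw [← Real.exp_add]; simp
      _ ≤ 1 := le_rfl
  · calc (n : ℝ) = Real.exp (Real.log n) := (Real.exp_log hn0').symm
      _ ≤ _ := Real.exp_le_exp.2 hKn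
  · calc (2 : ℝ) ^ q * Real.exp 1
        ≤ Real.exp (-(3 / ε)) * (ε * (8⁻¹ ^ q * c)) * Real.log n := hη
      _ = Real.exp (-(3 / ε)) * (ε * n * (8⁻¹ ^ q * (c * Real.log n / n))) := by field_simp
      _ ≤ _ := by gcongr

theorem theorem9 (q : ℕ) (hq : 1 ≤ q) (K P : ℕ → ℕ)
    (hKP : ∀ᶠ n in atTop, q ≤ K n ∧ K n ≤ P n)
    (c : ℝ) (hc : 1 < c)
    (hedge : ∀ᶠ n : ℕ in atTop,
      c * Real.log n / n ≤ 1 / (q.factorial : ℝ) * ((K n : ℝ) ^ (2 * q) / (P n : ℝ) ^ q))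
    (hKlog : Tendsto (fun n : ℕ => (K n : ℝ) / Real.log n) atTop atTop)
    (hKo : (fun n => (K n : ℝ)) =o[atTop]
      (fun n : ℕ => min (Real.sqrt (P n)) ((P n : ℝ) / n))) :
    Unsplittable q K P ∧ RemainsSecurelyConnected q K P := by
  have hKP' : ∀ᶠ n in atTop, K n ≤ P n := hKP.mono fun _ h => h.2
  have hlinked : ∀ ε : ℝ, 0 < ε → WithHighProbability K P fun _ R => LargeChunksLinked q ε R :=
    fun ε hε => withHighProbability_largeChunksLinked hq hKP' (by linarith) hedge hKlog hKo hε
  refine ⟨fun m _ ε hε => ?_, fun m hm => ?_⟩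
  · refine (hlinked ε hε).mono hKP' (Eventually.of_forall fun n R hR => ?_)
    rintro ⟨S, A, B, -, hsplit, hA, hB⟩
    exact hR.not_splitsInto hq hA hB hsplit
  -- Part 2 needs one ℓ = o(n), so ε = 1/(k + 1) must tend to 0 with n, slowly enough to keep the
  -- event likely.
  · obtain ⟨φ, hφ, hwhp⟩ := exists_tendsto_withHighProbability hKP'
      fun k : ℕ => hlinked (1 / ((k : ℝ) + 1)) (by positivity)
    have hε : Tendsto (fun n => 1 / ((φ n : ℝ) + 1)) atTop (𝓝 0) :=
      tendsto_one_div_add_atTop_nhds_zero_nat.comp hφ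
    refine ⟨fun n => m n + 1 / ((φ n : ℝ) + 1) * n, hm.add ?_, hwhp.mono hKP' ?_⟩
    · have h1 : (fun n => 1 / ((φ n : ℝ) + 1)) =o[atTop] fun _ => (1 : ℝ) :=
        (isLittleO_one_iff ℝ).2 hε
      simpa using h1.mul_isBigO (isBigO_refl (fun n : ℕ => (n : ℝ)) atTop)
    -- With |S| ≤ n/4 and εn ≤ n/4, the requirement 3εn ≤ n - |S| holds.
    · filter_upwards [hm.bound (by norm_num : (0 : ℝ) < 1 / 4), eventually_gt_atTop 0,
        hε.eventually_le_const (by norm_num : (0 : ℝ) < 1 / 4)] with n hmn hn hεn R hR S hS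
      have hn' : (0 : ℝ) < n := by exact_mod_cast hn
      have hS' : (S.card : ℝ) ≤ m n := by exact_mod_cast hS
      rw [Real.norm_of_nonneg (by positivity), Real.norm_of_nonneg (by positivity)] at hmn
      have h1 : 1 / ((φ n : ℝ) + 1) * n ≤ 1 / 4 * n := by gcongr
      obtain ⟨T, hTS, hT, hconn⟩ := hR.exists_connected (by positivity) (S := S) (by linarith)
      exact ⟨T, hTS, by linarith, hconn⟩
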